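/- Let $d\ge 3$. Let $\Delta$ be the discrete Laplacian on $\ell^2(\mathbb Z^d)$ (complex-valued sequences), $$(\Delta f)(n)=\tfrac12\sum_{j=1}^d\bigl(f(n+e_j)+f(n-e_j)\bigr),\qquad n\in\mathbb Z^d,$$ where $e_1,\dots,e_d$ is the standard basis of $\mathbb Z^d$. For $t\in\mathbb R$ let $(e^{it\Delta})(n)$, $n\in\mathbb Z^d$, denote the convolution kernel of $e^{it\Delta}$, i.e. $(e^{it\Delta})(n)=(e^{it\Delta}\delta_0)(n)$, where $\delta_0$ is the sequence equal to $1$ at $0$ and to $0$ elsewhere. For $m\in\mathbb Z$ let $J_m(t)=\frac1{2\pi}\int_0^{2\pi}e^{i(mk-t\sin k)}\,dk$ be the Bessel function of order $m$. (i) One has $$\beta:=\sup_{m\in\mathbb Z}\int_1^\infty|J_m(t)|^d\,dt<\infty,$$ and for each $n\in\mathbb Z^d$ and each choice of the sign $$\int_1^\infty\bigl|(e^{\pm it\Delta})(n)\bigr|\,dt\le\beta .$$ (ii) Let $\Lambda=\mathbb C\setminus[-d,d]$. For every $\lambda\in\Lambda$ the operator $\Delta-\lambda$ has a bounded inverse $R_0(\lambda)=(\Delta-\lambda)^{-1}$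 on $\ell^2(\mathbb Z^d)$. Let $q\in\ell^2(\mathbb Z^d)$, let $q$ also denote the operator of multiplication by $q$, and put $X(\lambda)=qR_0(\lambda)q$. Then $X(\lambda)$ is a Hilbert–Schmidt operator for every $\lambda\in\Lambda$, the function $X:\Lambda\to\mathcal B_2$ is analytic, where $\mathcal B_2$ is the Hilbert–Schmidt class with the Hilbert–Schmidt norm $\|\cdot\|_{\mathcal B_2}$, and $$\sup_{\lambda\in\Lambda}\|X(\lambda)\|_{\mathcal B_2}\le(1+\beta)\,\|q\|_2^2 .$$ -/

import Mathlib

open MeasureTheory Set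
open scoped ENNReal lp

/-- The Bessel function `J_m` of the first kind, of integer order `m`, on the real line, through
Bessel's integral `J_m(t) = (1 / 2π) ∫₀^{2π} exp (i (m k - t sin k)) dk`. -/
noncomputable def besselJ (m : ℤ) (t : ℝ) : ℂ :=
  (1 / (2 * (Real.pi : ℂ))) *
    ∫ k in (0 : ℝ)..(2 * Real.pi), Complex.exp (Complex.I * ((m : ℂ) * k - t * Real.sin k))

/-- `β = sup_{m ∈ ℤ} ∫_1^∞ |J_m(t)|^d dt`, as an extended nonnegative real number. -/
noncomputable def besselBeta (d : ℕ) : ℝ≥0∞ :=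
  ⨆ m : ℤ, ∫⁻ t in Ioi (1 : ℝ), ‖besselJ m t‖ₑ ^ d

/-- The lattice `ℤ^d`. -/
abbrev CubicLattice (d : ℕ) : Type := Fin d → ℤ

/-- The Hilbert space `ℓ²(ι)` of square summable complex functions on `ι`. -/
abbrev SqSum (ι : Type) : Type := lp (fun _ : ι => ℂ) 2

/-- Bounded operators on `ℓ²(ι)`. -/
abbrev BddOp (ι : Type) : Type := SqSum ι →L[ℂ] SqSum ι

/-- The basis vector `δ_n` of `ℓ²(ι)`. -/
noncomputable def delta {ι : Type} [DecidableEq ι] (n : ι) : SqSum ι := lp.single 2 n (1 : ℂ)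

theorem sqSum_norm_sq {ι : Type} {E : Type} [NormedAddCommGroup E] (f : lp (fun _ : ι => E) 2) :
    ‖f‖ ^ 2 = ∑' n, ‖f n‖ ^ 2 := by
  have h := lp.norm_rpow_eq_tsum (p := 2) (by norm_num) f
  simpa using h

theorem memlp_two_iff {ι : Type} {E : Type} [NormedAddCommGroup E] (f : ι → E) :
    Memℓp f 2 ↔ Summable fun n => ‖f n‖ ^ 2 := by
  have h := memℓp_gen_iff (p := 2) (by norm_num) (f := f)
  simpa using h

/-- Translation `(S_e f)(n) = f (n + e)` on `ℓ²(ℤ^d)`. -/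
noncomputable def shiftOp {d : ℕ} (e : CubicLattice d) : BddOp (CubicLattice d) :=
  LinearMap.mkContinuous
    { toFun := fun f => ⟨fun n => f (n + e), (memlp_two_iff _).2
        (((memlp_two_iff _).1 (lp.memℓp f)).comp_injective (add_left_injective e))⟩
      map_add' := fun _ _ => rfl
      map_smul' := fun _ _ => rfl } 1 (by
    intro f
    rw [one_mul]
    refine le_of_eq ((sq_eq_sq₀ (norm_nonneg _) (norm_nonneg _)).1 ?_)
    rw [sqSum_norm_sq, sqSum_norm_sq]
    exact (Equiv.addRight e).tsum_eq fun n => ‖f n‖ ^ 2)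

theorem shiftOp_apply {d : ℕ} (e : CubicLattice d) (f : SqSum (CubicLattice d))
    (n : CubicLattice d) : shiftOp e f n = f (n + e) := rfl

/-- The discrete Laplacian `(Δ f)(n) = (1/2) ∑_j (f (n + e_j) + f (n - e_j))` on `ℓ²(ℤ^d)`. -/
noncomputable def latticeLaplacian (d : ℕ) : BddOp (CubicLattice d) :=
  (1 / 2 : ℂ) • ∑ j : Fin d, (shiftOp (Pi.single j 1) + shiftOp (-Pi.single j 1))

theorem latticeLaplacian_apply (d : ℕ) (f : SqSum (CubicLattice d)) (n : CubicLattice d) :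
    latticeLaplacian d f n =
      (1 / 2) * ∑ j : Fin d, (f (n + Pi.single j 1) + f (n - Pi.single j 1)) := by
  simp only [latticeLaplacian, smul_apply, sum_apply, add_apply, sub_eq_add_neg]
  erw [lp.coeFn_smul, Pi.smul_apply, lp.coeFn_sum, Finset.sum_apply]
  rfl

/-- The unitary group `e^{itΔ}`, as the exponential series in the Banach algebra of bounded
operators. -/
noncomputable def laplacianGroup (d : ℕ) (t : ℝ) : BddOp (CubicLattice d) :=
  NormedSpace.exp ((Complex.I * t) • latticeLaplacian d)

/-- The convolution kernel `n ↦ (e^{itΔ})(n)` of `e^{itΔ}`: its matrix entry `(n, 0)`, which by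
translation invariance is also its matrix entry `(m, m')` whenever `m - m' = n`. -/
noncomputable def groupKernel (d : ℕ) (t : ℝ) (n : CubicLattice d) : ℂ :=
  laplacianGroup d t (delta 0) n

/-- Multiplication by `q ∈ ℓ²(ι)`, as a bounded operator on `ℓ²(ι)`. -/
noncomputable def mulOp {ι : Type} (q : SqSum ι) : BddOp ι :=
  have key : ∀ (f : SqSum ι) (n : ι), ‖q n * f n‖ ^ 2 ≤ ‖q‖ ^ 2 * ‖f n‖ ^ 2 := fun f n => by
    rw [norm_mul, mul_pow]
    gcongr
    exact lp.norm_apply_le_norm (by norm_num) q n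
  have sm : ∀ f : SqSum ι, Summable fun n => ‖q‖ ^ 2 * ‖f n‖ ^ 2 := fun f =>
    ((memlp_two_iff _).1 (lp.memℓp f)).mul_left _
  have mem : ∀ f : SqSum ι, Memℓp (fun n => q n * f n) 2 := fun f => (memlp_two_iff _).2
    (Summable.of_nonneg_of_le (fun _ => by positivity) (key f) (sm f))
  LinearMap.mkContinuous
    { toFun := fun f => ⟨fun n => q n * f n, mem f⟩
      map_add' := fun f g => by ext n; exact mul_add (q n) (f n) (g n)
      map_smul' := fun c f => by ext n; exact mul_left_comm (q n) c (f n) } ‖q‖ (by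
    intro f
    refine (sq_le_sq₀ (norm_nonneg _) (by positivity)).1 ?_
    rw [mul_pow, sqSum_norm_sq, sqSum_norm_sq f, ← tsum_mul_left]
    exact Summable.tsum_le_tsum (key f) ((memlp_two_iff _).1 (mem f)) (sm f))

theorem mulOp_apply {ι : Type} (q f : SqSum ι) (n : ι) : mulOp q f n = q n * f n := rfl

/-- The Hilbert–Schmidt operators on `ℓ²(ι)`, as a linear subspace of the bounded operators:
those `A` with `∑_n ‖A δ_n‖² < ∞`. -/
noncomputable def hsSubmodule (ι : Type) [DecidableEq ι] : Submodule ℂ (BddOp ι) where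
  carrier := {A | Memℓp (fun n => A (delta n)) 2}
  add_mem' := fun ha hb => ha.add hb
  zero_mem' := zero_memℓp
  smul_mem' := fun c _ ha => ha.const_smul c

/-- The Hilbert–Schmidt class `B₂` on `ℓ²(ι)`. It is a type of its own, so that it carries the
Hilbert–Schmidt norm below and not the operator norm. -/
def HilbertSchmidt (ι : Type) [DecidableEq ι] : Type := hsSubmodule ι

namespace HilbertSchmidt

variable {ι : Type} [DecidableEq ι]

noncomputable instance : AddCommGroup (HilbertSchmidt ι) :=
  inferInstanceAs (AddCommGroup (hsSubmodule ι))

noncomputable instance : Module ℂ (HilbertSchmidt ι) :=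
  inferInstanceAs (Module ℂ (hsSubmodule ι))

/-- The bounded operator underlying a Hilbert–Schmidt operator. -/
noncomputable def toOp : HilbertSchmidt ι →ₗ[ℂ] BddOp ι := (hsSubmodule ι).subtype

/-- The columns `(A δ_n)_n` of a Hilbert–Schmidt operator, a square summable family. -/
noncomputable def columns : HilbertSchmidt ι →ₗ[ℂ] lp (fun _ : ι => SqSum ι) 2 where
  toFun := fun A => ⟨fun n => toOp A (delta n), A.2⟩
  map_add' := fun _ _ => rfl
  map_smul' := fun _ _ => rfl

theorem columns_injective : Function.Injective (columns (ι := ι)) := by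
  intro A B h
  refine Subtype.ext (lp.ext_continuousLinearMap (by norm_num) fun n => ?_)
  ext1
  exact congrFun (congrArg Subtype.val h) n

/-- The Hilbert–Schmidt norm `‖A‖ = (∑_n ‖A δ_n‖²)^{1/2}`. -/
noncomputable instance : NormedAddCommGroup (HilbertSchmidt ι) :=
  NormedAddCommGroup.induced _ _ (columns (ι := ι)) columns_injective

noncomputable instance : NormedSpace ℂ (HilbertSchmidt ι) :=
  NormedSpace.induced ℂ _ _ (columns (ι := ι))

theorem norm_sq_eq (A : HilbertSchmidt ι) : ‖A‖ ^ 2 = ∑' n, ‖toOp A (delta n)‖ ^ 2 :=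
  sqSum_norm_sq (columns A)

end HilbertSchmidt

/-- The domain `Λ = ℂ ∖ [-d, d]`. -/
def cutPlane (d : ℕ) : Set ℂ := ((fun x : ℝ => (x : ℂ)) '' Icc (-(d : ℝ)) d)ᶜ

/-- The free resolvent `R₀(λ) = (Δ - λ)⁻¹`, the inverse in the algebra of bounded operators
(with the value `0` if `Δ - λ` is not invertible). -/
noncomputable def freeResolvent (d : ℕ) (z : ℂ) : BddOp (CubicLattice d) :=
  Ring.inverse (latticeLaplacian d - z • (1 : BddOp (CubicLattice d)))

/-!
The Fourier transform turns `Δ` into multiplication by `∑_j cos θ_j`, so the kernel of `e^{itΔ}` is a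
product over the coordinates of one-dimensional integrals, each of which is a Bessel function up to
a phase: `|(e^{itΔ})(n)| = ∏_j |J_{n_j}(t)|` (`norm_groupKernel`). Hölder's inequality with `d` equal
exponents bounds its time integral over `(1, ∞)` by `β` (`lintegral_groupKernel_le`).

That `β` is finite for `d ≥ 3` needs a bound on `J_m` that is uniform in `m` and has an integrable
cube. The bound `O(t^{-1/3})` just fails; what works is `|J_m(t)| ≤ 8 (1 + |t - |m||)^{-1/2}`
(`norm_besselJ_le`). By symmetry only the half period `[0, π]` matters, on which the phase
`m k - t sin k` is convex. For `t < |m|` it has no stationary point and the first derivative test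
gives `O(1 / (|m| - t))`. For `s = t - |m| ≥ 4`, the set where `|m - t cos k| ≤ √s`
is an interval between two values of `arccos`, on which `sin ≥ √(s / 2t)`; hence it has length
`O(1 / √s)`, and the first derivative test gives the same bound on both sides of it.

For the resolvent, `Δ` is self-adjoint with norm at most `d`, so its spectrum lies in `[-d, d]`. Off
the real axis `R₀(z)` is the Laplace transform of the unitary group, whose kernel is at most `1` on
`[0, 1]` and has integral at most `β` beyond; thus all matrix entries of `R₀(z)` are at most `1 + β`
(`norm_matrixEntry_freeResolvent_le`), at real `z` by continuity. A matrix bounded by `C` gives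
`‖q A q‖ ≤ C ‖q‖²` in the Hilbert–Schmidt norm (`norm_hsSandwich_le`). Analyticity holds because
`R₀` is analytic in the operator norm and `A ↦ q A q` is a bounded linear map from bounded to
Hilbert–Schmidt operators (`hsSandwich`).
-/

/-! ### The first derivative test -/

/-- **First derivative test** of van der Corput: an oscillatory integral whose phase `φ` has a
monotone derivative with `|φ'| ≥ c` is at most `4 / c`. -/
theorem norm_integral_exp_phase_le {φ φ' φ'' : ℝ → ℝ} {a b c : ℝ} (hab : a ≤ b) (hc : 0 < c)
    (hφ : ∀ x, HasDerivAt φ (φ' x) x) (hφ' : ∀ x, HasDerivAt φ' (φ'' x) x)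
    (hcont : Continuous φ'') (hmono : ∀ x ∈ Icc a b, 0 ≤ φ'' x)
    (hlow : ∀ x ∈ Icc a b, c ≤ |φ' x|) :
    ‖∫ x in a..b, Complex.exp (Complex.I * φ x)‖ ≤ 4 / c := by
  have hne : ∀ x ∈ Icc a b, φ' x ≠ 0 := fun x hx h => by
    have := hlow x hx
    rw [h, abs_zero] at this
    linarith
  have hneC : ∀ x ∈ Icc a b, (φ' x : ℂ) ≠ 0 := fun x hx => Complex.ofReal_ne_zero.2 (hne x hx)
  have cφ : Continuous φ := continuous_iff_continuousAt.2 fun x => (hφ x).continuousAt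
  have cφ' : Continuous φ' := continuous_iff_continuousAt.2 fun x => (hφ' x).continuousAt
  have hinv : ∀ x ∈ Icc a b, |(φ' x)⁻¹| ≤ 1 / c := fun x hx => by
    rw [abs_inv, ← one_div]
    exact one_div_le_one_div_of_le hc (hlow x hx)
  have ha : a ∈ Icc a b := left_mem_Icc.2 hab
  have hb : b ∈ Icc a b := right_mem_Icc.2 hab
  -- `G = e^{iφ} / (iφ')` has derivative `e^{iφ} + i e^{iφ} r`, and `r = φ'' / φ'²` is nonnegative with
  -- antiderivative `-1 / φ'`, so that its integral is bounded by the end point values of `1 / φ'`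
  set G : ℝ → ℂ := fun x => -Complex.I * Complex.exp (Complex.I * φ x) * (φ' x : ℂ)⁻¹ with hG
  set r : ℝ → ℝ := fun x => φ'' x / φ' x ^ 2 with hr
  have hGd : ∀ x ∈ uIcc a b, HasDerivAt G (Complex.exp (Complex.I * φ x)
      + Complex.I * Complex.exp (Complex.I * φ x) * (r x : ℂ)) x := by
    intro x hx
    rw [uIcc_of_le hab] at hx
    have h0 := hneC x hx
    have h1 : HasDerivAt (fun x => Complex.exp (Complex.I * φ x))
        (Complex.exp (Complex.I * φ x) * (Complex.I * φ' x)) x :=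
      ((hφ x).ofReal_comp.const_mul Complex.I).cexp
    have h2 := ((h1.const_mul (-Complex.I)).mul ((hφ' x).ofReal_comp.inv h0))
    refine h2.congr_deriv ?_
    simp only [hr, Pi.inv_apply]
    push_cast
    field_simp
    linear_combination (-(φ' x : ℂ) ^ 2) * Complex.I_sq
  have hrcont : ContinuousOn r (uIcc a b) := by
    rw [uIcc_of_le hab]
    exact hcont.continuousOn.div (cφ'.pow 2).continuousOn fun x hx => pow_ne_zero 2 (hne x hx)
  have hecont : Continuous fun x => Complex.exp (Complex.I * φ x) := by fun_prop
  have hi1 : IntervalIntegrable (fun x => Complex.exp (Complex.I * φ x)) volume a b :=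
    hecont.intervalIntegrable _ _
  have hi2 : IntervalIntegrable
      (fun x => Complex.I * Complex.exp (Complex.I * φ x) * (r x : ℂ)) volume a b :=
    ((continuous_const.mul hecont).continuousOn.mul
      (Complex.continuous_ofReal.comp_continuousOn hrcont)).intervalIntegrable
  have hFTC := intervalIntegral.integral_eq_sub_of_hasDerivAt hGd (hi1.add hi2)
  rw [intervalIntegral.integral_add hi1 hi2] at hFTC
  have hrint : ∫ x in a..b, r x = (φ' a)⁻¹ - (φ' b)⁻¹ := by
    have : ∀ x ∈ uIcc a b, HasDerivAt (fun x => -(φ' x)⁻¹) (r x) x := by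
      intro x hx
      rw [uIcc_of_le hab] at hx
      refine ((hφ' x).inv (hne x hx)).neg.congr_deriv ?_
      simp only [hr]
      ring
    rw [intervalIntegral.integral_eq_sub_of_hasDerivAt this hrcont.intervalIntegrable]
    ring
  have hnorm : ∀ x, ‖Complex.exp (Complex.I * φ x)‖ = 1 := fun x => by
    rw [mul_comm]; exact Complex.norm_exp_ofReal_mul_I _
  have hrem : ‖∫ x in a..b, Complex.I * Complex.exp (Complex.I * φ x) * (r x : ℂ)‖ ≤ 2 / c := by
    have h1 : ‖∫ x in a..b, Complex.I * Complex.exp (Complex.I * φ x) * (r x : ℂ)‖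
        ≤ ∫ x in a..b, r x := by
      refine intervalIntegral.norm_integral_le_of_norm_le hab ?_ hrcont.intervalIntegrable
      refine Filter.Eventually.of_forall fun x hx => ?_
      rw [norm_mul, norm_mul, hnorm, Complex.norm_I, one_mul, one_mul, Complex.norm_real,
        Real.norm_of_nonneg]
      exact div_nonneg (hmono x (Ioc_subset_Icc_self hx)) (sq_nonneg _)
    rw [hrint] at h1
    have h2 := abs_le.1 (hinv a ha)
    have h3 := abs_le.1 (hinv b hb)
    have : (2 : ℝ) / c = 1 / c + 1 / c := by ring
    linarith [h2.2, h3.1]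
  have hGn : ∀ x ∈ Icc a b, ‖G x‖ ≤ 1 / c := fun x hx => by
    simp only [hG, norm_mul, norm_neg, Complex.norm_I, hnorm, one_mul, ← Complex.ofReal_inv,
      Complex.norm_real]
    exact hinv x hx
  have heq : ∫ x in a..b, Complex.exp (Complex.I * φ x) = G b - G a -
      ∫ x in a..b, Complex.I * Complex.exp (Complex.I * φ x) * (r x : ℂ) := by
    rw [← hFTC]; ring
  rw [heq]
  calc _ ≤ ‖G b - G a‖ + ‖∫ x in a..b, Complex.I * Complex.exp (Complex.I * φ x) * (r x : ℂ)‖ :=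
        norm_sub_le _ _
    _ ≤ (‖G b‖ + ‖G a‖) + 2 / c := add_le_add (norm_sub_le _ _) hrem
    _ ≤ (1 / c + 1 / c) + 2 / c := by gcongr <;> exact hGn _ ‹_›
    _ = 4 / c := by ring

/-! ### Decay of Bessel functions away from the turning point -/

/-- The integral of the Bessel integrand `exp (i (m k - t sin k))` over `[a, b]`, without the factor
`1 / 2π`. -/
noncomputable def besselPartial (m : ℤ) (t a b : ℝ) : ℂ :=
  ∫ k in a..b, Complex.exp (Complex.I * ((m * k - t * Real.sin k : ℝ) : ℂ))

theorem besselPartial_add (m : ℤ) (t a b c : ℝ) :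
    besselPartial m t a b + besselPartial m t b c = besselPartial m t a c :=
  intervalIntegral.integral_add_adjacent_intervals
    (Continuous.intervalIntegrable (by fun_prop) _ _)
    (Continuous.intervalIntegrable (by fun_prop) _ _)

theorem norm_besselPartial_le_length (m : ℤ) (t : ℝ) {a b : ℝ} (hab : a ≤ b) :
    ‖besselPartial m t a b‖ ≤ b - a := by
  have := intervalIntegral.norm_integral_le_of_norm_le_const (C := 1) (a := a) (b := b)
    (f := fun k => Complex.exp (Complex.I * ((m * k - t * Real.sin k : ℝ) : ℂ)))
    (fun k _ => by rw [mul_comm]; exact (Complex.norm_exp_ofReal_mul_I _).le)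
  rwa [one_mul, abs_of_nonneg (sub_nonneg.2 hab)] at this

/-- The phase is convex on `[0, π]`, so the first derivative test applies to each subinterval on which
it has no stationary point. -/
theorem norm_besselPartial_le {m : ℤ} {t a b c : ℝ} (ht : 0 ≤ t) (ha : 0 ≤ a) (hab : a ≤ b)
    (hb : b ≤ Real.pi) (hc : 0 < c) (hlow : ∀ x ∈ Icc a b, c ≤ |m - t * Real.cos x|) :
    ‖besselPartial m t a b‖ ≤ 4 / c := by
  refine norm_integral_exp_phase_le (φ := fun k => m * k - t * Real.sin k)
    (φ' := fun k => m - t * Real.cos k) (φ'' := fun k => t * Real.sin k) hab hc ?_ ?_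
    (by fun_prop) ?_ hlow
  · intro x
    have := ((hasDerivAt_id' x).const_mul (m : ℝ)).sub ((Real.hasDerivAt_sin x).const_mul t)
    rwa [mul_one] at this
  · intro x
    simpa using ((Real.hasDerivAt_cos x).const_mul t).const_sub (m : ℝ)
  · intro x hx
    exact mul_nonneg ht (Real.sin_nonneg_of_nonneg_of_le_pi (ha.trans hx.1) (hx.2.trans hb))

/-- The reflection `k ↦ 2π - k` conjugates the integrand, so the half period `[0, π]` controls
the Bessel function. -/
theorem norm_besselJ_le_besselPartial (m : ℤ) (t : ℝ) :
    ‖besselJ m t‖ ≤ ‖besselPartial m t 0 Real.pi‖ / Real.pi := by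
  have hJ : besselJ m t = (1 / (2 * (Real.pi : ℂ))) * besselPartial m t 0 (2 * Real.pi) := by
    unfold besselJ besselPartial
    push_cast
    rfl
  have hrefl : besselPartial m t Real.pi (2 * Real.pi)
      = (starRingEnd ℂ) (besselPartial m t 0 Real.pi) := by
    unfold besselPartial
    rw [show (starRingEnd ℂ) (∫ k in (0 : ℝ)..Real.pi,
        Complex.exp (Complex.I * ((m * k - t * Real.sin k : ℝ) : ℂ))) = ∫ k in (0 : ℝ)..Real.pi,
        (starRingEnd ℂ) (Complex.exp (Complex.I * ((m * k - t * Real.sin k : ℝ) : ℂ))) by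
      simp_rw [intervalIntegral.integral_of_le Real.pi_pos.le, integral_conj]]
    have := intervalIntegral.integral_comp_sub_left (a := 0) (b := Real.pi)
      (fun k => Complex.exp (Complex.I * ((m * k - t * Real.sin k : ℝ) : ℂ))) (2 * Real.pi)
    rw [show 2 * Real.pi - Real.pi = Real.pi by ring, sub_zero] at this
    rw [← this]
    refine intervalIntegral.integral_congr fun k _ => ?_
    simp only [← Complex.exp_conj, map_mul, Complex.conj_I, Complex.conj_ofReal,
      Real.sin_two_pi_sub]
    rw [Complex.exp_eq_exp_iff_exists_int]
    refine ⟨m, ?_⟩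
    push_cast
    ring
  rw [hJ, ← besselPartial_add m t 0 Real.pi, hrefl, norm_mul]
  have h1 : ‖(1 / (2 * (Real.pi : ℂ)))‖ = 1 / (2 * Real.pi) := by
    rw [norm_div, norm_mul, Complex.norm_real, Real.norm_of_nonneg Real.pi_pos.le]
    simp
  rw [h1]
  calc _ ≤ 1 / (2 * Real.pi) * (‖besselPartial m t 0 Real.pi‖ + ‖besselPartial m t 0 Real.pi‖) := by
        gcongr
        refine (norm_add_le _ _).trans_eq ?_
        rw [RCLike.norm_conj]
    _ = _ := by field_simp; ring

theorem norm_besselJ_le_one (m : ℤ) (t : ℝ) : ‖besselJ m t‖ ≤ 1 := by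
  refine (norm_besselJ_le_besselPartial m t).trans ?_
  rw [div_le_one Real.pi_pos]
  simpa using norm_besselPartial_le_length m t Real.pi_pos.le

theorem norm_besselPartial_le_of_lt_order {m : ℤ} {t s : ℝ} (ht : 0 ≤ t) (hs : 0 < s)
    (h : t + s ≤ |(m : ℝ)|) : ‖besselPartial m t 0 Real.pi‖ ≤ 4 / s := by
  refine norm_besselPartial_le ht le_rfl Real.pi_pos.le le_rfl hs fun x _ => ?_
  have h1 : |t * Real.cos x| ≤ t := by
    rw [abs_mul, abs_of_nonneg ht]
    exact mul_le_of_le_one_right ht (Real.abs_cos_le_one x)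
  linarith [abs_sub_abs_le_abs_sub (m : ℝ) (t * Real.cos x)]

/-- Beyond the turning point `t = |m|` the phase has one stationary point in `[0, π]`. The piece
where `|φ'| ≤ √s` has length `O(1 / √s)`, and the first derivative test applies on the two sides
of it. -/
theorem norm_besselPartial_le_of_order_lt {m : ℤ} {t s : ℝ} (hs : 4 ≤ s)
    (h : |(m : ℝ)| + s = t) : ‖besselPartial m t 0 Real.pi‖ ≤ 12 / √s := by
  have hm := abs_nonneg (m : ℝ)
  have ht : 0 < t := by linarith
  set l := √s with hl
  have hll : l * l = s := Real.mul_self_sqrt (by linarith)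
  have hl2 : 2 ≤ l := by rw [hl]; exact Real.le_sqrt_of_sq_le (by linarith)
  have hls : l ≤ s / 2 := by nlinarith
  have hma := abs_le.1 (le_refl |(m : ℝ)|)
  have hA1 : (m + l) / t ≤ 1 := by rw [div_le_one ht]; linarith
  have hA2 : -1 ≤ (m - l) / t := by rw [le_div_iff₀ ht]; linarith
  have hAB : (m - l) / t ≤ (m + l) / t := by gcongr; linarith
  set k₁ := Real.arccos ((m + l) / t) with hk₁
  set k₂ := Real.arccos ((m - l) / t) with hk₂
  have h01 : 0 ≤ k₁ := Real.arccos_nonneg _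
  have h12 : k₁ ≤ k₂ := Real.arccos_le_arccos hAB
  have h2 : k₂ ≤ Real.pi := Real.arccos_le_pi _
  have hc1 : Real.cos k₁ = (m + l) / t := Real.cos_arccos (hA2.trans hAB) hA1
  have hc2 : Real.cos k₂ = (m - l) / t := Real.cos_arccos hA2 (hAB.trans hA1)
  have htc : ∀ u : ℝ, t * (u / t) = u := fun u => by field_simp
  have hI1 : ‖besselPartial m t 0 k₁‖ ≤ 4 / l := by
    refine norm_besselPartial_le ht.le le_rfl h01 (h12.trans h2) (by linarith) fun x hx => ?_
    have hcos := Real.cos_le_cos_of_nonneg_of_le_pi hx.1 (h12.trans h2) hx.2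
    rw [hc1] at hcos
    have := mul_le_mul_of_nonneg_left hcos ht.le
    rw [htc] at this
    rw [abs_sub_comm]
    exact le_trans (by linarith) (le_abs_self _)
  have hI3 : ‖besselPartial m t k₂ Real.pi‖ ≤ 4 / l := by
    refine norm_besselPartial_le ht.le (h01.trans h12) h2 le_rfl (by linarith) fun x hx => ?_
    have hcos := Real.cos_le_cos_of_nonneg_of_le_pi (h01.trans h12) hx.2 hx.1
    rw [hc2] at hcos
    have := mul_le_mul_of_nonneg_left hcos ht.le
    rw [htc] at this
    exact le_trans (by linarith) (le_abs_self _)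
  have hlen : k₂ - k₁ ≤ 4 / l := by
    have hsin : ∀ x ∈ Icc k₁ k₂, l / (2 * t) ≤ Real.sin x / l := by
      intro x hx
      have hx0 : 0 ≤ x := h01.trans hx.1
      have hxp : x ≤ Real.pi := hx.2.trans h2
      have e1 := Real.cos_le_cos_of_nonneg_of_le_pi h01 hxp hx.1
      have e2 := Real.cos_le_cos_of_nonneg_of_le_pi hx0 h2 hx.2
      rw [hc1, le_div_iff₀ ht] at e1
      rw [hc2, div_le_iff₀ ht] at e2
      have e3 : |Real.cos x| * t ≤ |(m : ℝ)| + l := by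
        have : |Real.cos x| * t = |Real.cos x * t| := by rw [abs_mul, abs_of_pos ht]
        rw [this]
        exact abs_le.2 ⟨by linarith, by linarith⟩
      have e4 : |Real.cos x| ≤ 1 := Real.abs_cos_le_one x
      have e5 : s / 2 ≤ (1 - |Real.cos x|) * t := by linarith
      have e6 : 1 - |Real.cos x| ≤ Real.sin x ^ 2 := by
        rw [Real.sin_sq, ← sq_abs (Real.cos x)]
        nlinarith [abs_nonneg (Real.cos x)]
      have e7 : 0 ≤ Real.sin x := Real.sin_nonneg_of_nonneg_of_le_pi hx0 hxp
      have e8 : s / 2 ≤ Real.sin x ^ 2 * t := e5.trans (by gcongr)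
      rw [div_le_div_iff₀ (by positivity) (by linarith), hll]
      -- `(s / t)² ≤ s / t ≤ 2 sin² x`
      have e9 : s ^ 2 ≤ (Real.sin x * (2 * t)) ^ 2 := by nlinarith
      exact (sq_le_sq₀ (by linarith) (by positivity)).1 e9
    have hint := intervalIntegral.integral_mono_on (μ := volume) h12
      (f := fun _ => l / (2 * t)) (g := fun x => Real.sin x / l) (by simp)
      (Continuous.intervalIntegrable (by fun_prop) _ _) hsin
    rw [intervalIntegral.integral_const, intervalIntegral.integral_div, integral_sin, hc1, hc2,
      smul_eq_mul] at hint
    have e : ((m + l) / t - (m - l) / t) / l = 2 / t := by field_simp; ring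
    rw [e] at hint
    rw [le_div_iff₀ (by linarith)]
    have := mul_le_mul_of_nonneg_right hint (show 0 ≤ 2 * t by positivity)
    have e' : (k₂ - k₁) * (l / (2 * t)) * (2 * t) = (k₂ - k₁) * l := by field_simp
    have e'' : 2 / t * (2 * t) = 4 := by field_simp; ring
    rwa [e', e''] at this
  have hI2 := norm_besselPartial_le_length m t h12
  rw [← besselPartial_add m t 0 k₁, ← besselPartial_add m t k₁ k₂]
  calc _ ≤ ‖besselPartial m t 0 k₁‖ + (‖besselPartial m t k₁ k₂‖ + ‖besselPartial m t k₂ Real.pi‖) :=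
        (norm_add_le _ _).trans (by gcongr; exact norm_add_le _ _)
    _ ≤ 4 / l + (4 / l + 4 / l) := by gcongr; exact hI2.trans hlen
    _ = 12 / l := by ring

/-- Decay of `J_m` away from the turning point, uniformly in the order. -/
theorem norm_besselJ_le (m : ℤ) {t : ℝ} (ht : 0 ≤ t) :
    ‖besselJ m t‖ ≤ 8 / √(1 + abs (t - |(m : ℝ)|)) := by
  have hx0 : 0 ≤ abs (t - |(m : ℝ)|) := abs_nonneg _
  rcases lt_or_ge (abs (t - |(m : ℝ)|)) 4 with hx | hx
  · refine (norm_besselJ_le_one m t).trans ?_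
    rw [le_div_iff₀ (by positivity), one_mul]
    exact Real.sqrt_le_iff.2 ⟨by norm_num, by linarith⟩
  set x := abs (t - |(m : ℝ)|) with hxdef
  have hsx : 2 ≤ √x := Real.le_sqrt_of_sq_le (by linarith)
  have hhalf : ‖besselPartial m t 0 Real.pi‖ ≤ 12 / √x := by
    rcases le_total |(m : ℝ)| t with h | h
    · exact norm_besselPartial_le_of_order_lt hx (by rw [hxdef, abs_of_nonneg (sub_nonneg.2 h)]; ring)
    · have h1 : t + x ≤ |(m : ℝ)| := by
        rw [hxdef, abs_of_nonpos (sub_nonpos.2 h)]; linarith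
      refine (norm_besselPartial_le_of_lt_order ht (by linarith) h1).trans ?_
      have : √x * √x = x := Real.mul_self_sqrt hx0
      gcongr
      · norm_num
      · nlinarith
  have hsq : √(1 + x) ≤ 2 * √x := by
    refine Real.sqrt_le_iff.2 ⟨by positivity, ?_⟩
    rw [mul_pow, Real.sq_sqrt hx0]
    linarith
  calc ‖besselJ m t‖ ≤ ‖besselPartial m t 0 Real.pi‖ / Real.pi := norm_besselJ_le_besselPartial m t
    _ ≤ (12 / √x) / 3 := by gcongr; exact Real.pi_gt_three.le
    _ = 8 / (2 * √x) := by field_simp; norm_num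
    _ ≤ 8 / √(1 + x) := by gcongr

/-- The decay bound `|J_m(t)| ≤ 8 (1 + |t - |m||)^{-1/2}` has an integrable cube, and the integral of
the cube over `ℝ` does not depend on `m`; as `|J_m| ≤ 1`, exponents `d ≥ 3` reduce to `3`. -/
theorem besselBeta_lt_top {d : ℕ} (hd : 3 ≤ d) : besselBeta d < ⊤ := by
  set g : ℝ → ℝ := fun x => 512 * (1 + ‖x‖) ^ (-(3 / 2) : ℝ) with hg
  have hgi : Integrable g := (integrable_one_add_norm (by simp; norm_num)).const_mul 512
  refine lt_of_le_of_lt (iSup_le fun m => ?_) hgi.hasFiniteIntegral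
  calc ∫⁻ t in Ioi (1 : ℝ), ‖besselJ m t‖ₑ ^ d
      ≤ ∫⁻ t in Ioi (1 : ℝ), ‖g (t - |(m : ℝ)|)‖ₑ := by
        refine setLIntegral_mono' measurableSet_Ioi fun t ht => ?_
        rw [← enorm_pow, enorm_le_iff_norm_le, norm_pow]
        have h0 : 0 < 1 + abs (t - |(m : ℝ)|) := by positivity
        calc ‖besselJ m t‖ ^ d ≤ ‖besselJ m t‖ ^ 3 :=
              pow_le_pow_of_le_one (norm_nonneg _) (norm_besselJ_le_one m t) hd
          _ ≤ (8 / √(1 + abs (t - |(m : ℝ)|))) ^ 3 := by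
              gcongr
              exact norm_besselJ_le m (zero_le_one.trans (le_of_lt ht))
          _ = g (t - |(m : ℝ)|) := by
              rw [hg, div_pow, Real.sqrt_eq_rpow, ← Real.rpow_natCast (_ ^ (1 / 2 : ℝ)),
                ← Real.rpow_mul h0.le]
              simp only [Real.norm_eq_abs]
              rw [Real.rpow_neg h0.le]
              norm_num
              rfl
          _ ≤ ‖g (t - |(m : ℝ)|)‖ := le_abs_self _
    _ ≤ ∫⁻ t, ‖g (t - |(m : ℝ)|)‖ₑ := setLIntegral_le_lintegral _ _
    _ = ∫⁻ t, ‖g t‖ₑ := lintegral_sub_right_eq_self (fun t => ‖g t‖ₑ) _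

/-! ### Bessel functions as Fourier coefficients on the circle -/

theorem continuous_besselJ (m : ℤ) : Continuous (besselJ m) := by
  unfold besselJ
  refine continuous_const.mul ?_
  exact intervalIntegral.continuous_parametric_intervalIntegral_of_continuous' (by fun_prop) _ _

theorem periodic_phase (m : ℤ) (t : ℝ) (f : ℝ → ℝ) (hf : Function.Periodic f (2 * Real.pi)) :
    Function.Periodic (fun k : ℝ => Complex.exp (Complex.I * ((m : ℂ) * k + t * f k)))
      (2 * Real.pi) := by
  intro k
  simp only [hf k]
  rw [Complex.exp_eq_exp_iff_exists_int]
  refine ⟨m, ?_⟩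
  push_cast
  ring

/-- Shifting the variable of a `2π`-periodic phase only multiplies the integral by a unimodular
constant. -/
theorem integral_phase_shift (m : ℤ) (t a : ℝ) (f : ℝ → ℝ)
    (hf : Function.Periodic f (2 * Real.pi)) :
    ‖∫ k in (0 : ℝ)..(2 * Real.pi), Complex.exp (Complex.I * ((m : ℂ) * k + t * f k))‖ =
      ‖∫ k in (0 : ℝ)..(2 * Real.pi), Complex.exp (Complex.I * ((m : ℂ) * k + t * f (k + a)))‖ := by
  have h1 := (periodic_phase m t f hf).intervalIntegral_add_eq 0 a
  have h2 := intervalIntegral.integral_comp_add_right (a := 0) (b := 2 * Real.pi)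
    (fun k : ℝ => Complex.exp (Complex.I * ((m : ℂ) * k + t * f k))) a
  rw [zero_add, add_comm (2 * Real.pi) a] at h2
  rw [zero_add] at h1
  rw [h1, ← h2]
  have h3 : ∀ k : ℝ, Complex.exp (Complex.I * ((m : ℂ) * (k + a : ℝ) + t * f (k + a))) =
      Complex.exp (((m * a : ℝ) : ℂ) * Complex.I) *
        Complex.exp (Complex.I * ((m : ℂ) * k + t * f (k + a))) := by
    intro k
    rw [← Complex.exp_add]
    push_cast
    congr 1
    ring
  simp_rw [h3]
  rw [intervalIntegral.integral_const_mul, norm_mul, Complex.norm_exp_ofReal_mul_I, one_mul]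

/-- The shift `k ↦ k + π / 2` turns the symbol `cos` of the Laplacian into the `-sin` of Bessel's
integral. -/
theorem norm_integral_cos_phase (m : ℤ) (t : ℝ) :
    ‖(1 / (2 * (Real.pi : ℂ))) * ∫ k in (0 : ℝ)..(2 * Real.pi),
      Complex.exp (Complex.I * ((m : ℂ) * k + t * Real.cos k))‖ = ‖besselJ m t‖ := by
  unfold besselJ
  rw [norm_mul, norm_mul, integral_phase_shift m t (Real.pi / 2) Real.cos Real.cos_periodic]
  simp only [Real.cos_add_pi_div_two, Complex.ofReal_neg, mul_neg, ← sub_eq_add_neg]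

theorem norm_besselJ_neg (m : ℤ) (t : ℝ) : ‖besselJ m (-t)‖ = ‖besselJ m t‖ := by
  rw [← norm_integral_cos_phase m t]
  unfold besselJ
  rw [norm_mul, norm_mul,
    integral_phase_shift m t (-(Real.pi / 2)) Real.cos Real.cos_periodic]
  simp only [← sub_eq_add_neg, Real.cos_sub_pi_div_two, Complex.ofReal_neg, neg_mul,
    sub_neg_eq_add]

/-! ### Matrix entries and the Fourier representation on the torus -/

theorem delta_apply {ι : Type} [DecidableEq ι] (n m : ι) :
    delta n m = if m = n then (1 : ℂ) else 0 := by
  unfold delta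
  rw [lp.single_apply, Pi.single_apply]

/-- The matrix entry `A ↦ (A δ_n)(m)`, as a bounded linear functional on operators. -/
noncomputable def matrixEntry {ι : Type} [DecidableEq ι] (m n : ι) : BddOp ι →L[ℂ] ℂ :=
  (lp.evalCLM ℂ (fun _ : ι => ℂ) 2 m).comp (ContinuousLinearMap.apply ℂ _ (delta n))

theorem matrixEntry_apply {ι : Type} [DecidableEq ι] (m n : ι) (A : BddOp ι) :
    matrixEntry m n A = A (delta n) m := rfl

/-- The product of the Lebesgue measures on the circles `(0, 2π]`, of total mass `(2π)^d`. -/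
noncomputable def torusMeasure (d : ℕ) : Measure (Fin d → ℝ) :=
  Measure.pi fun _ => volume.restrict (Ioc 0 (2 * Real.pi))

instance (d : ℕ) : IsFiniteMeasure (torusMeasure d) := by
  unfold torusMeasure; infer_instance

/-- The character `θ ↦ e^{i n·θ}` of the torus. -/
noncomputable def torusChar {d : ℕ} (n : CubicLattice d) (θ : Fin d → ℝ) : ℂ :=
  ∏ j, Complex.exp (Complex.I * ((n j : ℂ) * θ j))

/-- The Fourier symbol `∑_j cos θ_j` of the Laplacian. -/
noncomputable def laplacianSymbol {d : ℕ} (θ : Fin d → ℝ) : ℂ := ∑ j, (Real.cos (θ j) : ℂ)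

theorem continuous_torusChar {d : ℕ} (n : CubicLattice d) : Continuous (torusChar n) := by
  unfold torusChar; fun_prop

theorem continuous_laplacianSymbol {d : ℕ} : Continuous (laplacianSymbol (d := d)) := by
  unfold laplacianSymbol; fun_prop

theorem norm_torusChar {d : ℕ} (n : CubicLattice d) (θ : Fin d → ℝ) : ‖torusChar n θ‖ = 1 := by
  unfold torusChar
  rw [norm_prod]
  refine Finset.prod_eq_one fun j _ => ?_
  have : Complex.I * ((n j : ℂ) * θ j) = ((n j * θ j : ℝ) : ℂ) * Complex.I := by push_cast; ring
  rw [this, Complex.norm_exp_ofReal_mul_I]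

theorem norm_laplacianSymbol_le {d : ℕ} (θ : Fin d → ℝ) : ‖laplacianSymbol θ‖ ≤ d := by
  unfold laplacianSymbol
  refine (norm_sum_le _ _).trans ?_
  have : ∀ j ∈ (Finset.univ : Finset (Fin d)), ‖(Real.cos (θ j) : ℂ)‖ ≤ 1 := fun j _ => by
    rw [Complex.norm_real]; exact Real.abs_cos_le_one _
  simpa using Finset.sum_le_sum this

theorem torusChar_add_single {d : ℕ} (n : CubicLattice d) (j : Fin d) (s : ℤ) (θ : Fin d → ℝ) :
    torusChar (n + Pi.single j s) θ =
      torusChar n θ * Complex.exp (Complex.I * ((s : ℂ) * θ j)) := by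
  have h : Complex.exp (Complex.I * ((s : ℂ) * θ j)) =
      ∏ i, Complex.exp (Complex.I * (((Pi.single j s : CubicLattice d) i : ℂ) * θ i)) := by
    rw [Finset.prod_eq_single j (fun i _ hi => by simp [Pi.single_eq_of_ne hi]) (by simp)]
    simp
  rw [h]
  unfold torusChar
  rw [← Finset.prod_mul_distrib]
  refine Finset.prod_congr rfl fun i _ => ?_
  rw [← Complex.exp_add, Pi.add_apply]
  push_cast
  congr 1
  ring

/-- The characters are generalized eigenfunctions of the Laplacian. -/
theorem torusChar_symbol {d : ℕ} (n : CubicLattice d) (θ : Fin d → ℝ) :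
    (1 / 2 : ℂ) * ∑ j, (torusChar (n + Pi.single j 1) θ + torusChar (n - Pi.single j 1) θ) =
      laplacianSymbol θ * torusChar n θ := by
  unfold laplacianSymbol
  rw [Finset.mul_sum, Finset.sum_mul]
  refine Finset.sum_congr rfl fun j _ => ?_
  have : n - Pi.single j 1 = n + Pi.single j (-1) := by rw [Pi.single_neg, sub_eq_add_neg]
  rw [this, torusChar_add_single, torusChar_add_single, Complex.ofReal_cos, Complex.cos]
  push_cast
  rw [mul_comm Complex.I, mul_comm Complex.I, one_mul, neg_one_mul]
  ring

theorem integrable_torus {d : ℕ} {f : (Fin d → ℝ) → ℂ} (hf : Continuous f) {C : ℝ}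
    (hC : ∀ θ, ‖f θ‖ ≤ C) : Integrable f (torusMeasure d) :=
  Integrable.of_bound hf.aestronglyMeasurable C (Filter.Eventually.of_forall hC)

theorem integral_circle_exp (m : ℤ) :
    (1 / (2 * (Real.pi : ℂ))) * ∫ k in Ioc 0 (2 * Real.pi), Complex.exp (Complex.I * ((m : ℂ) * k))
      = if m = 0 then 1 else 0 := by
  rw [← intervalIntegral.integral_of_le Real.two_pi_pos.le]
  have hpi : (Real.pi : ℂ) ≠ 0 := Complex.ofReal_ne_zero.2 Real.pi_ne_zero
  split_ifs with h
  · subst h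
    simp
    field_simp
  · have hm : (m : ℂ) * Complex.I ≠ 0 := mul_ne_zero (Int.cast_ne_zero.2 h) Complex.I_ne_zero
    have e : ∀ k : ℝ, Complex.I * ((m : ℂ) * k) = ((m : ℂ) * Complex.I) * k := fun k => by ring
    simp_rw [e]
    rw [integral_exp_mul_complex hm]
    have : Complex.exp ((m : ℂ) * Complex.I * ((2 * Real.pi : ℝ) : ℂ)) = 1 := by
      rw [Complex.exp_eq_one_iff]
      exact ⟨m, by push_cast; ring⟩
    rw [this]
    simp

/-- Fourier representation of the powers of the Laplacian. -/
theorem matrixEntry_latticeLaplacian_pow (d k : ℕ) (n : CubicLattice d) :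
    matrixEntry n 0 (latticeLaplacian d ^ k) = (1 / (2 * (Real.pi : ℂ))) ^ d *
      ∫ θ, laplacianSymbol θ ^ k * torusChar n θ ∂torusMeasure d := by
  induction k generalizing n with
  | zero =>
    simp only [pow_zero, one_mul, matrixEntry_apply]
    rw [show (1 : BddOp (CubicLattice d)) (delta 0) = delta 0 from rfl, delta_apply]
    unfold torusChar torusMeasure
    rw [integral_fintype_prod_eq_prod (𝕜 := ℂ)
      (fun j (x : ℝ) => Complex.exp (Complex.I * ((n j : ℂ) * x)))]
    have : (1 / (2 * (Real.pi : ℂ))) ^ d = ∏ _j : Fin d, (1 / (2 * (Real.pi : ℂ))) := by simp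
    rw [this, ← Finset.prod_mul_distrib]
    simp_rw [integral_circle_exp]
    rw [Finset.prod_ite_zero, Finset.prod_const_one]
    simp [funext_iff]
  | succ k ih =>
    have hint : ∀ m : CubicLattice d, Integrable
        (fun θ => laplacianSymbol θ ^ k * torusChar m θ) (torusMeasure d) := fun m => by
      refine integrable_torus ((continuous_laplacianSymbol.pow k).mul (continuous_torusChar m))
        (C := (d : ℝ) ^ k) fun θ => ?_
      rw [norm_mul, norm_torusChar, mul_one, norm_pow]
      exact pow_le_pow_left₀ (norm_nonneg _) (norm_laplacianSymbol_le θ) k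
    rw [matrixEntry_apply, pow_succ', mul_apply_eq_comp, latticeLaplacian_apply]
    simp only [matrixEntry_apply] at ih
    simp only [ih]
    have : ∀ θ : Fin d → ℝ, laplacianSymbol θ ^ (k + 1) * torusChar n θ =
        (1 / 2) * ∑ j, (laplacianSymbol θ ^ k * torusChar (n + Pi.single j 1) θ +
          laplacianSymbol θ ^ k * torusChar (n - Pi.single j 1) θ) := fun θ => by
      rw [pow_succ, mul_assoc, ← torusChar_symbol]
      simp_rw [← mul_add, ← Finset.mul_sum]
      ring
    simp_rw [this]
    rw [integral_const_mul, integral_finsetSum _ fun j _ =>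
      (show Integrable (fun θ => laplacianSymbol θ ^ k * torusChar (n + Pi.single j 1) θ +
        laplacianSymbol θ ^ k * torusChar (n - Pi.single j 1) θ) (torusMeasure d) from
        (hint _).add (hint _))]
    simp_rw [integral_add (hint _) (hint _), ← mul_add, ← Finset.mul_sum]
    ring

/-- Fourier representation of the kernel of `e^{itΔ}`. -/
theorem groupKernel_eq_integral (d : ℕ) (t : ℝ) (n : CubicLattice d) :
    groupKernel d t n = (1 / (2 * (Real.pi : ℂ))) ^ d *
      ∫ θ, Complex.exp (Complex.I * t * laplacianSymbol θ) * torusChar n θ ∂torusMeasure d := by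
  have h1 : HasSum (fun k : ℕ => matrixEntry n 0
      (((k.factorial : ℂ))⁻¹ • ((Complex.I * t) • latticeLaplacian d) ^ k)) (groupKernel d t n) :=
    (matrixEntry n 0).hasSum (NormedSpace.exp_series_hasSum_exp' (𝕂 := ℂ) _)
  have h2 : HasSum (fun k : ℕ => ∫ θ, (((k.factorial : ℂ))⁻¹ *
      (Complex.I * t * laplacianSymbol θ) ^ k) * torusChar n θ ∂torusMeasure d)
      (∫ θ, Complex.exp (Complex.I * t * laplacianSymbol θ) * torusChar n θ ∂torusMeasure d) := by
    refine hasSum_integral_of_dominated_convergence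
      (fun k _ => (|t| * d) ^ k / k.factorial) (fun k => ?_) (fun k => ?_)
      (Filter.Eventually.of_forall fun _ => Real.summable_pow_div_factorial _)
      (integrable_const _) (Filter.Eventually.of_forall fun θ => ?_)
    · exact ((continuous_const.mul ((continuous_const.mul continuous_laplacianSymbol).pow k)).mul
        (continuous_torusChar n)).aestronglyMeasurable
    · refine Filter.Eventually.of_forall fun θ => ?_
      rw [norm_mul, norm_torusChar, mul_one, norm_mul, norm_inv, norm_pow, norm_mul, norm_mul,
        Complex.norm_I, one_mul, Complex.norm_real, Real.norm_eq_abs, Complex.norm_natCast,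
        inv_mul_eq_div]
      gcongr
      exact norm_laplacianSymbol_le θ
    · have := NormedSpace.exp_series_hasSum_exp' (𝕂 := ℂ) (Complex.I * t * laplacianSymbol θ)
      rw [← Complex.exp_eq_exp_ℂ] at this
      exact this.mul_right _
  refine h1.unique ((h2.mul_left ((1 / (2 * (Real.pi : ℂ))) ^ d)).congr_fun fun k => ?_)
  rw [smul_pow, smul_smul, map_smul, matrixEntry_latticeLaplacian_pow, smul_eq_mul,
    mul_left_comm, ← integral_const_mul]
  congr 2
  ext θ
  ring

/-- The kernel of `e^{itΔ}` factorizes over the coordinates into Bessel functions, up to a phase. -/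
theorem norm_groupKernel (d : ℕ) (t : ℝ) (n : CubicLattice d) :
    ‖groupKernel d t n‖ = ∏ j, ‖besselJ (n j) t‖ := by
  rw [groupKernel_eq_integral]
  have h : ∀ θ : Fin d → ℝ, Complex.exp (Complex.I * t * laplacianSymbol θ) * torusChar n θ =
      ∏ j, Complex.exp (Complex.I * ((n j : ℂ) * θ j + t * Real.cos (θ j))) := fun θ => by
    unfold laplacianSymbol torusChar
    rw [Finset.mul_sum, Complex.exp_sum, ← Finset.prod_mul_distrib]
    refine Finset.prod_congr rfl fun j _ => ?_
    rw [← Complex.exp_add]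
    congr 1
    ring
  simp_rw [h]
  unfold torusMeasure
  rw [integral_fintype_prod_eq_prod (𝕜 := ℂ)
    (fun j (x : ℝ) => Complex.exp (Complex.I * ((n j : ℂ) * x + t * Real.cos x)))]
  have : (1 / (2 * (Real.pi : ℂ))) ^ d = ∏ _j : Fin d, (1 / (2 * (Real.pi : ℂ))) := by simp
  rw [this, ← Finset.prod_mul_distrib, norm_prod]
  refine Finset.prod_congr rfl fun j _ => ?_
  rw [← norm_integral_cos_phase, intervalIntegral.integral_of_le Real.two_pi_pos.le]

theorem norm_groupKernel_le_one (d : ℕ) (t : ℝ) (n : CubicLattice d) :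
    ‖groupKernel d t n‖ ≤ 1 := by
  rw [norm_groupKernel]
  exact Finset.prod_le_one (fun _ _ => norm_nonneg _) fun _ _ => norm_besselJ_le_one _ _

theorem norm_groupKernel_neg (d : ℕ) (t : ℝ) (n : CubicLattice d) :
    ‖groupKernel d (-t) n‖ = ‖groupKernel d t n‖ := by
  simp_rw [norm_groupKernel, norm_besselJ_neg]

/-! ### Time integrals of the kernel -/

/-- Hölder's inequality with `d` exponents equal to `d`, applied to the product formula for the
kernel. -/
theorem lintegral_groupKernel_le {d : ℕ} (hd : d ≠ 0) (n : CubicLattice d) :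
    (∫⁻ t in Ioi (1 : ℝ), ‖groupKernel d t n‖ₑ) ≤ besselBeta d := by
  have hd' : (d : ℝ) ≠ 0 := Nat.cast_ne_zero.2 hd
  have h1 : ∀ t : ℝ, ‖groupKernel d t n‖ₑ =
      ∏ j : Fin d, (‖besselJ (n j) t‖ₑ ^ d) ^ (1 / (d : ℝ)) := fun t => by
    rw [← ofReal_norm, norm_groupKernel,
      ENNReal.ofReal_prod_of_nonneg fun _ _ => norm_nonneg _]
    refine Finset.prod_congr rfl fun j _ => ?_
    rw [ofReal_norm, ← ENNReal.rpow_natCast, ← ENNReal.rpow_mul, mul_one_div_cancel hd', ENNReal.rpow_one]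
  simp_rw [h1]
  refine (ENNReal.lintegral_prod_norm_pow_le _
    (fun j _ => ((continuous_besselJ (n j)).enorm.measurable.pow_const d).aemeasurable)
    (by simp [hd']) (fun _ _ => by positivity)).trans ?_
  calc _ ≤ ∏ _j : Fin d, besselBeta d ^ (1 / (d : ℝ)) := by
        refine Finset.prod_le_prod' fun j _ => ENNReal.rpow_le_rpow ?_ (by positivity)
        exact le_iSup (fun m : ℤ => ∫⁻ t in Ioi (1 : ℝ), ‖besselJ m t‖ₑ ^ d) (n j)
    _ = besselBeta d := by
        rw [Finset.prod_const, Finset.card_univ, Fintype.card_fin, ← ENNReal.rpow_natCast,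
          ← ENNReal.rpow_mul, one_div_mul_cancel hd', ENNReal.rpow_one]

theorem lintegral_groupKernel_neg_le {d : ℕ} (hd : d ≠ 0) (n : CubicLattice d) :
    (∫⁻ t in Ioi (1 : ℝ), ‖groupKernel d (-t) n‖ₑ) ≤ besselBeta d := by
  refine le_of_eq_of_le (lintegral_congr fun t => ?_) (lintegral_groupKernel_le hd n)
  exact enorm_eq_iff_norm_eq.2 (norm_groupKernel_neg d t n)

/-! ### Spectrum and unitary group of the Laplacian -/

theorem norm_shiftOp_le {d : ℕ} (e : CubicLattice d) : ‖shiftOp e‖ ≤ 1 :=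
  LinearMap.mkContinuous_norm_le _ zero_le_one _

theorem norm_latticeLaplacian_le (d : ℕ) : ‖latticeLaplacian d‖ ≤ d := by
  unfold latticeLaplacian
  rw [norm_smul]
  have h : ‖∑ j : Fin d, (shiftOp (Pi.single j 1) + shiftOp (-Pi.single j 1) :
      BddOp (CubicLattice d))‖ ≤ ∑ _j : Fin d, (2 : ℝ) := by
    refine norm_sum_le_of_le _ fun j _ => (norm_add_le _ _).trans ?_
    linarith [norm_shiftOp_le (d := d) (Pi.single j 1), norm_shiftOp_le (d := d) (-Pi.single j 1)]
  simp only [Finset.sum_const, Finset.card_univ, Fintype.card_fin, nsmul_eq_mul] at h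
  have h2 : ‖(1 / 2 : ℂ)‖ = 1 / 2 := by norm_num
  rw [h2]
  linarith

theorem star_shiftOp {d : ℕ} (e : CubicLattice d) : star (shiftOp e) = shiftOp (-e) := by
  rw [ContinuousLinearMap.star_eq_adjoint]
  symm
  rw [ContinuousLinearMap.eq_adjoint_iff]
  intro f g
  rw [lp.inner_eq_tsum, lp.inner_eq_tsum, ← (Equiv.addRight e).tsum_eq]
  refine tsum_congr fun n => ?_
  simp only [Equiv.coe_addRight, shiftOp_apply, add_neg_cancel_right]

theorem isSelfAdjoint_latticeLaplacian (d : ℕ) : IsSelfAdjoint (latticeLaplacian d) := by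
  rw [isSelfAdjoint_iff]
  unfold latticeLaplacian
  rw [star_smul, star_sum]
  simp only [star_add, star_shiftOp, neg_neg]
  congr 1
  · simp
  · exact Finset.sum_congr rfl fun j _ => add_comm _ _

instance (d : ℕ) : Nontrivial (SqSum (CubicLattice d)) :=
  ⟨⟨delta 0, 0, fun h => by
    have := congrArg (fun f : SqSum (CubicLattice d) => f 0) h
    simp [delta_apply] at this⟩⟩

theorem isUnit_latticeLaplacian_sub (d : ℕ) {z : ℂ} (hz : z ∈ cutPlane d) :
    IsUnit (latticeLaplacian d - z • (1 : BddOp (CubicLattice d))) := by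
  by_contra h
  have hmem : z ∈ spectrum ℂ (latticeLaplacian d) := by
    rw [spectrum.mem_iff, Algebra.algebraMap_eq_smul_one, IsUnit.sub_iff]
    exact h
  have him := (isSelfAdjoint_latticeLaplacian d).im_eq_zero_of_mem_spectrum hmem
  have hn := (spectrum.norm_le_norm_of_mem hmem).trans (norm_latticeLaplacian_le d)
  exact hz ⟨z.re, abs_le.1 ((Complex.abs_re_le_norm z).trans hn),
    Complex.ext (Complex.ofReal_re _) (by simp [him])⟩

theorem commute_shiftOp_latticeLaplacian {d : ℕ} (e : CubicLattice d) :
    Commute (shiftOp e) (latticeLaplacian d) := by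
  refine ContinuousLinearMap.ext fun f => ?_
  ext n
  rw [mul_apply_eq_comp, mul_apply_eq_comp, shiftOp_apply, latticeLaplacian_apply,
    latticeLaplacian_apply]
  simp only [shiftOp_apply, add_right_comm, sub_add_eq_add_sub]

/-- Translation invariance of `e^{itΔ}`: its matrix is a convolution. -/
theorem matrixEntry_laplacianGroup (d : ℕ) (t : ℝ) (m n : CubicLattice d) :
    matrixEntry m n (laplacianGroup d t) = groupKernel d t (m - n) := by
  let : NormedAlgebra ℚ (BddOp (CubicLattice d)) := NormedAlgebra.restrictScalars ℚ ℂ _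
  have hc : Commute (shiftOp (-n)) (laplacianGroup d t) :=
    ((commute_shiftOp_latticeLaplacian (-n)).smul_right _).exp_right
  have hδ : delta n = shiftOp (-n) (delta 0) := by
    ext k
    rw [shiftOp_apply, delta_apply, delta_apply, ← sub_eq_add_neg]
    simp only [sub_eq_zero]
  rw [matrixEntry_apply, hδ, ← mul_apply_eq_comp, ← hc.eq, mul_apply_eq_comp, shiftOp_apply,
    sub_eq_add_neg]
  rfl

theorem norm_laplacianGroup (d : ℕ) (t : ℝ) : ‖laplacianGroup d t‖ = 1 := by
  let : NormedAlgebra ℚ (BddOp (CubicLattice d)) := NormedAlgebra.restrictScalars ℚ ℂ _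
  refine CStarRing.norm_of_mem_unitary (NormedSpace.exp_mem_unitary_of_mem_skewAdjoint ?_)
  rw [skewAdjoint.mem_iff, star_smul, (isSelfAdjoint_latticeLaplacian d).star_eq, ← neg_smul]
  simp

theorem norm_delta {ι : Type} [DecidableEq ι] (n : ι) : ‖(delta n : SqSum ι)‖ = 1 := by
  unfold delta
  rw [lp.norm_single (by norm_num)]
  exact norm_one

theorem norm_matrixEntry_le {ι : Type} [DecidableEq ι] (m n : ι) (A : BddOp ι) :
    ‖matrixEntry m n A‖ ≤ ‖A‖ := by
  rw [matrixEntry_apply]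
  refine (lp.norm_apply_le_norm (by norm_num) _ m).trans ((A.le_opNorm _).trans_eq ?_)
  rw [norm_delta, mul_one]

theorem continuous_groupKernel (d : ℕ) (n : CubicLattice d) :
    Continuous fun t => groupKernel d t n := by
  let : NormedAlgebra ℚ (BddOp (CubicLattice d)) := NormedAlgebra.restrictScalars ℚ ℂ _
  have : Continuous fun t : ℝ => matrixEntry n 0 (laplacianGroup d t) := by
    refine (matrixEntry n 0).continuous.comp (NormedSpace.exp_continuous.comp ?_)
    fun_prop
  exact this

/-- On `[0, 1]` the kernel is at most `1`, and beyond `1` its integral is at most `β`. -/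
theorem integral_norm_groupKernel_le {d : ℕ} (hd : 3 ≤ d) (n : CubicLattice d)
    {T : ℝ} (hT : 1 ≤ T) :
    ∫ t in (0 : ℝ)..T, ‖groupKernel d t n‖ ≤ 1 + (besselBeta d).toReal := by
  have hK := continuous_groupKernel d n
  have hi : ∀ a b, IntervalIntegrable (fun t => ‖groupKernel d t n‖) volume a b :=
    fun a b => hK.norm.intervalIntegrable a b
  have hle := lintegral_groupKernel_le (d := d) (by omega) n
  have hlt : (∫⁻ t in Ioi (1 : ℝ), ‖groupKernel d t n‖ₑ) < ⊤ :=
    hle.trans_lt (besselBeta_lt_top hd)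
  have hint : IntegrableOn (fun t => groupKernel d t n) (Ioi 1) :=
    ⟨hK.aestronglyMeasurable, hlt⟩
  rw [← intervalIntegral.integral_add_adjacent_intervals (hi 0 1) (hi 1 T)]
  refine add_le_add ?_ ?_
  · have := intervalIntegral.integral_mono_on zero_le_one (hi 0 1)
      (g := fun _ => (1 : ℝ)) (by simp) fun t _ => norm_groupKernel_le_one d t n
    simpa using this
  · rw [intervalIntegral.integral_of_le hT]
    refine (setIntegral_mono_set hint.norm (Filter.Eventually.of_forall fun _ => norm_nonneg _)
      Ioc_subset_Ioi_self.eventuallyLE).trans ?_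
    rw [integral_norm_eq_lintegral_enorm hint.aestronglyMeasurable]
    exact ENNReal.toReal_mono (besselBeta_lt_top hd).ne hle

/-! ### The resolvent kernel -/

theorem freeResolvent_mul_cancel {d : ℕ} {z : ℂ} (hz : z ∈ cutPlane d) :
    (latticeLaplacian d - z • (1 : BddOp (CubicLattice d))) * freeResolvent d z = 1 :=
  Ring.mul_inverse_cancel _ (isUnit_latticeLaplacian_sub d hz)

/-- The semigroup generated by `-iσ (Δ - z)` is `e^{iσtz} e^{-iσtΔ}`. -/
theorem exp_resolvent_flow (d : ℕ) (z : ℂ) (σ t : ℝ) :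
    NormedSpace.exp (t • ((-(Complex.I * σ)) •
      (latticeLaplacian d - z • (1 : BddOp (CubicLattice d))))) =
      Complex.exp (Complex.I * (σ * t * z)) • laplacianGroup d (-(σ * t)) := by
  let : NormedAlgebra ℚ (BddOp (CubicLattice d)) := NormedAlgebra.restrictScalars ℚ ℂ _
  have h : t • ((-(Complex.I * σ)) • (latticeLaplacian d - z • (1 : BddOp (CubicLattice d)))) =
      (Complex.I * (σ * t * z)) • (1 : BddOp (CubicLattice d)) +
        (Complex.I * ((-(σ * t) : ℝ) : ℂ)) • latticeLaplacian d := by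
    have e : ∀ B : BddOp (CubicLattice d), t • B = (t : ℂ) • B := fun B => rfl
    rw [e]
    push_cast
    module
  rw [h, NormedSpace.exp_add_of_commute ((Commute.one_left _).smul_left _),
    ← Algebra.algebraMap_eq_smul_one, ← NormedSpace.algebraMap_exp_comm,
    Algebra.algebraMap_eq_smul_one, smul_one_mul, ← Complex.exp_eq_exp_ℂ]
  rfl

theorem norm_exp_resolvent_factor (z : ℂ) (σ t : ℝ) :
    ‖Complex.exp (Complex.I * (σ * t * z))‖ = Real.exp (-(t * (σ * z.im))) := by
  rw [Complex.norm_exp]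
  congr 1
  simp
  ring

/-- Off the real axis the resolvent is `R₀(z) = iσ ∫₀^∞ e^{iσtz} e^{-iσtΔ} dt`, where
`σ = ±1` has the sign of `Im z`. -/
theorem norm_matrixEntry_freeResolvent_le_of_im {d : ℕ} (hd : 3 ≤ d) {z : ℂ}
    (hz : z ∈ cutPlane d) {σ : ℝ} (hσ : |σ| = 1) (him : 0 < σ * z.im) (m n : CubicLattice d) :
    ‖matrixEntry m n (freeResolvent d z)‖ ≤ 1 + (besselBeta d).toReal := by
  set R := freeResolvent d z with hR
  set A : BddOp (CubicLattice d) := (-(Complex.I * σ)) •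
    (latticeLaplacian d - z • (1 : BddOp (CubicLattice d))) with hA
  have hAR : A * R = (-(Complex.I * σ)) • 1 := by
    rw [hA, smul_mul_assoc, freeResolvent_mul_cancel hz]
  -- `h` runs from `R_{mn}` at `0` to `0` at infinity, and its derivative is the kernel of `e^{-iσtΔ}`
  -- times a factor of modulus at most `1`
  set h : ℝ → ℂ := fun t => matrixEntry m n (NormedSpace.exp (t • A) * R) with hh
  set h' : ℝ → ℂ := fun t => (-(Complex.I * σ)) * matrixEntry m n (NormedSpace.exp (t • A))
    with hh'
  have hd1 : ∀ t, HasDerivAt h (h' t) t := fun t => by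
    have h1 := (hasDerivAt_exp_smul_const A t).mul_const R
    rw [mul_assoc, hAR, mul_smul_comm, mul_one] at h1
    have h2 := ((matrixEntry m n).restrictScalars ℝ).hasFDerivAt.comp_hasDerivAt t h1
    exact h2.congr_deriv ((matrixEntry m n).map_smul _ _)
  have hcexp : Continuous fun t : ℝ => NormedSpace.exp (t • A) := by
    let : NormedAlgebra ℚ (BddOp (CubicLattice d)) := NormedAlgebra.restrictScalars ℚ ℂ _
    exact NormedSpace.exp_continuous.comp (by fun_prop)
  have hch' : Continuous h' := continuous_const.mul ((matrixEntry m n).continuous.comp hcexp)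
  have hσC : ‖-(Complex.I * (σ : ℂ))‖ = 1 := by simpa using hσ
  have hkernel : ∀ t, ‖groupKernel d (-(σ * t)) (m - n)‖ = ‖groupKernel d t (m - n)‖ := fun t => by
    rcases (abs_eq zero_le_one).1 hσ with h | h
    · rw [h, one_mul, norm_groupKernel_neg]
    · rw [h, neg_one_mul, neg_neg]
  have hb' : ∀ t, 0 ≤ t → ‖h' t‖ ≤ ‖groupKernel d t (m - n)‖ := fun t ht => by
    simp only [hh', hA]
    rw [norm_mul, hσC, one_mul, exp_resolvent_flow, map_smul, matrixEntry_laplacianGroup,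
      norm_smul, norm_exp_resolvent_factor, hkernel]
    refine mul_le_of_le_one_left (norm_nonneg _) (Real.exp_le_one_iff.2 ?_)
    exact neg_nonpos.2 (mul_nonneg ht him.le)
  have hbT : ∀ t, ‖h t‖ ≤ Real.exp (-(t * (σ * z.im))) * ‖R‖ := fun t => by
    simp only [hh, hA]
    refine (norm_matrixEntry_le _ _ _).trans ((norm_mul_le _ _).trans_eq ?_)
    rw [exp_resolvent_flow, norm_smul, norm_exp_resolvent_factor, norm_laplacianGroup, mul_one]
  have h0 : h 0 = matrixEntry m n R := by simp [hh]
  have hlim : Filter.Tendsto (fun T : ℝ => Real.exp (-(T * (σ * z.im))) * ‖R‖ +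
      (1 + (besselBeta d).toReal)) Filter.atTop (nhds (0 * ‖R‖ + (1 + (besselBeta d).toReal))) := by
    refine ((Real.tendsto_exp_neg_atTop_nhds_zero.comp ?_).mul_const _).add_const _
    exact Filter.tendsto_id.atTop_mul_const him
  rw [zero_mul, zero_add] at hlim
  refine ge_of_tendsto hlim ((Filter.eventually_ge_atTop 1).mono fun T hT => ?_)
  have hT0 : (0 : ℝ) ≤ T := zero_le_one.trans hT
  have hFTC := intervalIntegral.integral_eq_sub_of_hasDerivAt (fun t _ => hd1 t)
    (hch'.intervalIntegrable 0 T)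
  have hK := continuous_groupKernel d (m - n)
  have hI : ‖∫ t in (0 : ℝ)..T, h' t‖ ≤ 1 + (besselBeta d).toReal := by
    refine (intervalIntegral.norm_integral_le_of_norm_le hT0 ?_
      (hK.norm.intervalIntegrable 0 T)).trans (integral_norm_groupKernel_le hd _ hT)
    exact Filter.Eventually.of_forall fun t ht => hb' t ht.1.le
  have : matrixEntry m n R = h T - ∫ t in (0 : ℝ)..T, h' t := by rw [hFTC, h0]; ring
  rw [this]
  exact (norm_sub_le _ _).trans (add_le_add (hbT T) hI)

theorem analyticAt_freeResolvent {d : ℕ} {z : ℂ} (hz : z ∈ cutPlane d) :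
    AnalyticAt ℂ (freeResolvent d) z := by
  obtain ⟨u, hu⟩ := isUnit_latticeLaplacian_sub d hz
  have h1 : AnalyticAt ℂ (fun z : ℂ => latticeLaplacian d - z • (1 : BddOp (CubicLattice d))) z :=
    analyticAt_const.sub (analyticAt_id.smul analyticAt_const)
  have h2 := analyticAt_inverse (𝕜 := ℂ) u
  rw [hu] at h2
  have h3 : AnalyticAt ℂ (fun z : ℂ => Ring.inverse
      (latticeLaplacian d - z • (1 : BddOp (CubicLattice d)))) z := AnalyticAt.fun_comp h2 h1
  exact h3

/-- The resolvent kernel is bounded uniformly on `Λ`; real points are reached by continuity. -/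
theorem norm_matrixEntry_freeResolvent_le {d : ℕ} (hd : 3 ≤ d) {z : ℂ} (hz : z ∈ cutPlane d)
    (m n : CubicLattice d) :
    ‖matrixEntry m n (freeResolvent d z)‖ ≤ 1 + (besselBeta d).toReal := by
  rcases lt_trichotomy z.im 0 with him | him | him
  · exact norm_matrixEntry_freeResolvent_le_of_im hd hz (σ := -1) (by simp) (by simpa) m n
  · have hlim : Filter.Tendsto (fun ε : ℝ => z + ε * Complex.I) (nhdsWithin 0 (Ioi 0))
        (nhds z) := by
      have : Continuous fun ε : ℝ => z + ε * Complex.I := by fun_prop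
      simpa using (this.tendsto 0).mono_left nhdsWithin_le_nhds
    have hcont := ((matrixEntry m n).continuous.tendsto _).comp
      ((analyticAt_freeResolvent hz).continuousAt.tendsto.comp hlim)
    refine le_of_tendsto hcont.norm ?_
    filter_upwards [self_mem_nhdsWithin] with ε hε
    have hε' : (z + ε * Complex.I).im = ε := by simp [him]
    refine norm_matrixEntry_freeResolvent_le_of_im hd ?_ (σ := 1) (by simp) ?_ m n
    · rintro ⟨x, _, hx⟩
      have := congrArg Complex.im hx
      rw [hε'] at this
      exact absurd this (ne_of_lt hε)
    · rw [hε', one_mul]; exact hε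
  · exact norm_matrixEntry_freeResolvent_le_of_im hd hz (σ := 1) (by simp) (by simpa) m n

/-! ### Hilbert–Schmidt sandwiches -/

theorem mulOp_delta {ι : Type} [DecidableEq ι] (q : SqSum ι) (n : ι) :
    mulOp q (delta n) = q n • delta n := by
  ext m
  rw [mulOp_apply, lp.coeFn_smul, Pi.smul_apply, delta_apply, smul_eq_mul]
  split_ifs with h
  · rw [h]
  · simp

theorem norm_mulOp_le {ι : Type} (q : SqSum ι) : ‖mulOp q‖ ≤ ‖q‖ := by
  unfold mulOp
  exact LinearMap.mkContinuous_norm_le _ (norm_nonneg _) _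

theorem sandwich_delta {ι : Type} [DecidableEq ι] (q : SqSum ι) (A : BddOp ι) (n : ι) :
    (mulOp q ∘L A ∘L mulOp q) (delta n) = q n • mulOp q (A (delta n)) := by
  simp [mulOp_delta]

theorem norm_sq_sandwich_delta_le {ι : Type} [DecidableEq ι] (q : SqSum ι) (A : BddOp ι) (n : ι) :
    ‖(mulOp q ∘L A ∘L mulOp q) (delta n)‖ ^ 2 ≤ (‖q‖ * ‖A‖) ^ 2 * ‖q n‖ ^ 2 := by
  rw [sandwich_delta, norm_smul, mul_pow, mul_comm]
  gcongr
  refine ((mulOp q).le_opNorm _).trans ?_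
  gcongr
  · exact norm_mulOp_le q
  · simpa [norm_delta] using A.le_opNorm (delta n)

theorem summable_norm_sq {ι : Type} (q : SqSum ι) : Summable fun n => ‖q n‖ ^ 2 :=
  (memlp_two_iff _).1 (lp.memℓp q)

theorem sandwich_mem_hsSubmodule {ι : Type} [DecidableEq ι] (q : SqSum ι) (A : BddOp ι) :
    mulOp q ∘L A ∘L mulOp q ∈ hsSubmodule ι :=
  (memlp_two_iff _).2 (Summable.of_nonneg_of_le (fun _ => by positivity)
    (norm_sq_sandwich_delta_le q A) ((summable_norm_sq q).mul_left _))

/-- The map `A ↦ q A q` from bounded operators to Hilbert–Schmidt operators, as a bounded linear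
map. Composition with it transfers analyticity from the operator norm to the Hilbert–Schmidt
norm. -/
noncomputable def hsSandwich {ι : Type} [DecidableEq ι] (q : SqSum ι) :
    BddOp ι →L[ℂ] HilbertSchmidt ι :=
  LinearMap.mkContinuous
    { toFun := fun A => (⟨mulOp q ∘L A ∘L mulOp q, sandwich_mem_hsSubmodule q A⟩ : hsSubmodule ι)
      map_add' := fun A B => Subtype.ext (by
        change mulOp q ∘L (A + B) ∘L mulOp q = mulOp q ∘L A ∘L mulOp q + mulOp q ∘L B ∘L mulOp q
        rw [ContinuousLinearMap.add_comp, ContinuousLinearMap.comp_add])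
      map_smul' := fun c A => Subtype.ext (by
        change mulOp q ∘L (c • A) ∘L mulOp q = c • (mulOp q ∘L A ∘L mulOp q)
        rw [ContinuousLinearMap.smul_comp, ContinuousLinearMap.comp_smul]) } (‖q‖ ^ 2) (by
    intro A
    refine (sq_le_sq₀ (norm_nonneg _) (by positivity)).1 ?_
    rw [HilbertSchmidt.norm_sq_eq]
    refine (Summable.tsum_le_tsum (norm_sq_sandwich_delta_le q A)
      ((memlp_two_iff _).1 (sandwich_mem_hsSubmodule q A))
      ((summable_norm_sq q).mul_left _)).trans_eq ?_
    rw [tsum_mul_left, ← sqSum_norm_sq]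
    ring)

theorem toOp_hsSandwich {ι : Type} [DecidableEq ι] (q : SqSum ι) (A : BddOp ι) :
    HilbertSchmidt.toOp (hsSandwich q A) = mulOp q ∘L A ∘L mulOp q := rfl

/-- If the matrix of `A` is bounded by `C`, then `‖q A q‖² = ∑ |q_m|² |A_{mn}|² |q_n|²` is at most
`C² ‖q‖⁴`. -/
theorem norm_hsSandwich_le {ι : Type} [DecidableEq ι] (q : SqSum ι) (A : BddOp ι) {C : ℝ}
    (hC : ∀ m n, ‖matrixEntry m n A‖ ≤ C) (hC0 : 0 ≤ C) : ‖hsSandwich q A‖ ≤ C * ‖q‖ ^ 2 := by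
  have hcol : ∀ n, ‖HilbertSchmidt.toOp (hsSandwich q A) (delta n)‖ ^ 2 ≤
      (C * ‖q‖) ^ 2 * ‖q n‖ ^ 2 := fun n => by
    rw [toOp_hsSandwich, sandwich_delta, norm_smul, mul_pow, mul_comm]
    gcongr ?_ * _
    rw [sqSum_norm_sq, mul_pow, sqSum_norm_sq q, ← tsum_mul_left]
    refine Summable.tsum_le_tsum (fun m => ?_) (summable_norm_sq _)
      ((summable_norm_sq q).mul_left _)
    rw [mulOp_apply, norm_mul, mul_pow, mul_comm]
    gcongr
    exact hC m n
  refine (sq_le_sq₀ (norm_nonneg _) (by positivity)).1 ?_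
  rw [HilbertSchmidt.norm_sq_eq]
  refine (Summable.tsum_le_tsum hcol ((memlp_two_iff _).1 (sandwich_mem_hsSubmodule q A))
    ((summable_norm_sq q).mul_left _)).trans_eq ?_
  rw [tsum_mul_left, ← sqSum_norm_sq]
  ring

theorem theorem7p3 (d : ℕ) (hd : 3 ≤ d) :
    (besselBeta d < ⊤ ∧
      ∀ n : CubicLattice d,
        (∫⁻ t in Ioi (1 : ℝ), ‖groupKernel d t n‖ₑ) ≤ besselBeta d ∧
        (∫⁻ t in Ioi (1 : ℝ), ‖groupKernel d (-t) n‖ₑ) ≤ besselBeta d) ∧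
    (∀ z ∈ cutPlane d, IsUnit (latticeLaplacian d - z • (1 : BddOp (CubicLattice d)))) ∧
    ∀ q : SqSum (CubicLattice d), ∃ X : ℂ → HilbertSchmidt (CubicLattice d),
      (∀ z ∈ cutPlane d,
        HilbertSchmidt.toOp (X z) = mulOp q ∘L freeResolvent d z ∘L mulOp q) ∧
      AnalyticOnNhd ℂ X (cutPlane d) ∧
      ∀ z ∈ cutPlane d, ‖X z‖ ≤ (1 + (besselBeta d).toReal) * ‖q‖ ^ 2 := by
  have hd0 : d ≠ 0 := by omega
  refine ⟨⟨besselBeta_lt_top hd, fun n =>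
    ⟨lintegral_groupKernel_le hd0 n, lintegral_groupKernel_neg_le hd0 n⟩⟩,
    fun z hz => isUnit_latticeLaplacian_sub d hz, fun q =>
    ⟨fun z => hsSandwich q (freeResolvent d z), fun z _ => toOp_hsSandwich q _, fun z hz => ?_,
      fun z hz => ?_⟩⟩
  · exact ((hsSandwich q).analyticAt _).comp (analyticAt_freeResolvent hz)
  · exact norm_hsSandwich_le q _ (norm_matrixEntry_freeResolvent_le hd hz)
      (add_nonneg zero_le_one ENNReal.toReal_nonneg)
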